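/- Let $n\ge 1$ and let $\alpha\in\mathbb R^n$ have a component equal to $1$. Write $|x|=\max_i|x_i|$ for $x\in\mathbb R^n$ and $x\cdot y=\sum_i x_iy_i$. A linear subspace of $\mathbb R^n$ is called rational if it has a basis of vectors with rational components. Let $F_\alpha$ be the smallest rational subspace of $\mathbb R^n$ containing $\alpha$, let $d$ be its dimension, and let $\Lambda_\alpha=F_\alpha\cap\mathbb Z^n$, a lattice in $F_\alpha$. Let $|\Lambda_\alpha|$ be the co-volume of $\Lambda_\alpha$, i.e. the $d$-dimensional Euclidean volume of a fundamental domain of the torus $F_\alpha/\Lambda_\alpha$, and put $$C_{d,\alpha}=d^2\,d!\,|\Lambda_\alpha|^2,\qquad Q_\alpha=\inf\{|k| : k\in\Lambda_\alpha\setminus\{0\}\},$$ $$\Psi_\alpha(Q)=\max\{|k\cdot\alpha|^{-1} : k\in\Lambda_\alpha,\ 0<|k|\le Q\}\qquad (Q\ge Q_\alpha).$$ Equip $F_\alpha/\Lambda_\alpha$ with the metric induced by $|\cdot|$, and call a subset $\delta$-dense if every point of the torus is at distance at most $\delta$ from some point of the subset. Let the $\delta$-ergodization time $T_\alpha(\delta)$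 be the smallest $T\ge 0$ such that the piece of orbit $\{t\alpha \bmod \Lambda_\alpha : 0\le t\le T\}$ is $\delta$-dense in $F_\alpha/\Lambda_\alpha$. Then, for every real $\delta$ with $0<\delta\le d^2\big((n+2)Q_\alpha\big)^{-1}$, the time $T_\alpha(\delta)$ exists and $$T_\alpha(\delta)\le C_{d,\alpha}\,\Psi_\alpha\big(2C_{d,\alpha}\,\delta^{-1}\big).$$ -/

import Mathlib

open MeasureTheory

noncomputable section

namespace LinearFlow

variable {n : ℕ}

/-- The norm `|x| = max {|x_1|, …, |x_n|}` on `ℝⁿ`. The space `ℝⁿ` itself is taken with its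
Euclidean structure, which is used only to measure volumes. -/
def maxNorm (x : EuclideanSpace ℝ (Fin n)) : ℝ := ‖(WithLp.ofLp x : Fin n → ℝ)‖

/-- A vector subspace of `ℝⁿ` is rational if it admits a basis of vectors with rational
components. -/
def IsRational (V : Submodule ℝ (EuclideanSpace ℝ (Fin n))) : Prop :=
  ∃ s : Set (EuclideanSpace ℝ (Fin n)),
    (∀ v ∈ s, ∀ i, ∃ q : ℚ, v i = (q : ℝ)) ∧
    LinearIndepOn ℝ id s ∧ Submodule.span ℝ s = V

/-- `F_α`, the smallest rational subspace of `ℝⁿ` that contains `α`: the intersection of all of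
them, which is again rational. -/
def ratHull (α : EuclideanSpace ℝ (Fin n)) : Submodule ℝ (EuclideanSpace ℝ (Fin n)) :=
  sInf {V | IsRational V ∧ α ∈ V}

theorem mem_ratHull (α : EuclideanSpace ℝ (Fin n)) : α ∈ ratHull α :=
  Submodule.mem_sInf.2 fun _ hV => hV.2

/-- `d`, the dimension of `F_α`. -/
def dim (α : EuclideanSpace ℝ (Fin n)) : ℕ := Module.finrank ℝ (ratHull α)

/-- `Λ_α = F_α ∩ ℤⁿ`, as a lattice in `F_α`. -/
def lattice (α : EuclideanSpace ℝ (Fin n)) : Submodule ℤ (ratHull α) where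
  carrier := {x | ∀ i, ∃ m : ℤ, (x : EuclideanSpace ℝ (Fin n)) i = (m : ℝ)}
  zero_mem' := fun i => ⟨0, by simp⟩
  add_mem' := by
    intro x y hx hy i
    obtain ⟨a, ha⟩ := hx i
    obtain ⟨b, hb⟩ := hy i
    exact ⟨a + b, by simp [ha, hb]⟩
  smul_mem' := by
    intro c x hx i
    obtain ⟨a, ha⟩ := hx i
    exact ⟨c * a, by simp [ha]⟩

/-- `|Λ_α|`, the co-volume of `Λ_α`: the `d`-dimensional volume of a fundamental domain of
`F_α / Λ_α`, with respect to the Lebesgue measure of the Euclidean space `F_α`. -/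
def covol (α : EuclideanSpace ℝ (Fin n)) : ℝ := ZLattice.covolume (lattice α) volume

/-- `Q_α`, the length of the shortest non-zero vector of `Λ_α`. -/
def shortest (α : EuclideanSpace ℝ (Fin n)) : ℝ :=
  sInf {r | ∃ k ∈ lattice α, k ≠ 0 ∧ r = maxNorm (k : EuclideanSpace ℝ (Fin n))}

/-- `Ψ_α(Q) = max {|k · α|⁻¹ | k ∈ Λ_α, 0 < |k| ≤ Q}`, for `Q ≥ Q_α`. The set is finite, so
that its supremum is a maximum, and `k · α ≠ 0` for all non-zero `k ∈ Λ_α`. -/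
def Psi (α : EuclideanSpace ℝ (Fin n)) (Q : ℝ) : ℝ :=
  sSup {r | ∃ k ∈ lattice α, 0 < maxNorm (k : EuclideanSpace ℝ (Fin n)) ∧
    maxNorm (k : EuclideanSpace ℝ (Fin n)) ≤ Q ∧
    r = |∑ i, (k : EuclideanSpace ℝ (Fin n)) i * α i|⁻¹}

/-- The `d`-dimensional torus `F_α / Λ_α`. -/
abbrev Torus (α : EuclideanSpace ℝ (Fin n)) : Type := ratHull α ⧸ lattice α

/-- The linear flow `θ ↦ θ + t α` on the torus `F_α / Λ_α`. -/
def flow (α : EuclideanSpace ℝ (Fin n)) (t : ℝ) (θ : Torus α) : Torus α :=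
  θ + (lattice α).mkQ (t • ⟨α, mem_ratHull α⟩)

/-- The piece of orbit `⋃_{0 ≤ t ≤ T} X_α^t(0)`. -/
def orbitPiece (α : EuclideanSpace ℝ (Fin n)) (T : ℝ) : Set (Torus α) :=
  {θ | ∃ t : ℝ, 0 ≤ t ∧ t ≤ T ∧ θ = flow α t 0}

/-- The metric on the torus `F_α / Λ_α` induced by the norm `|·|` on `F_α`. -/
def torusDist {α : EuclideanSpace ℝ (Fin n)} (θ θ' : Torus α) : ℝ :=
  sInf {r | ∃ x : ratHull α, (lattice α).mkQ x = θ - θ' ∧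
    r = maxNorm (x : EuclideanSpace ℝ (Fin n))}

/-- A subset of the torus is `δ`-dense if every point of the torus is at distance at most `δ` from
some point of the subset. -/
def IsDense {α : EuclideanSpace ℝ (Fin n)} (δ : ℝ) (S : Set (Torus α)) : Prop :=
  ∀ θ : Torus α, ∃ θ' ∈ S, torusDist θ θ' ≤ δ

/-- The times `T` for which the piece of orbit of length `T` is `δ`-dense. -/
def denseTimes (α : EuclideanSpace ℝ (Fin n)) (δ : ℝ) : Set ℝ :=
  {T | 0 ≤ T ∧ IsDense δ (orbitPiece α T)}

/-- `T_α(δ)`, the `δ`-ergodization time. -/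
def ergodizationTime (α : EuclideanSpace ℝ (Fin n)) (δ : ℝ) : ℝ := sInf (denseTimes α δ)

/-- `C_{d,α} = d² d! |Λ_α|²`. -/
def const (α : EuclideanSpace ℝ (Fin n)) : ℝ :=
  (dim α : ℝ) ^ 2 * ((dim α).factorial : ℝ) * covol α ^ 2

end LinearFlow

end

noncomputable section

namespace LinearFlow

/-! ### Transference between a lattice and its dual -/

section Covering

/-! Write `F`, `Λ`, `D`, `C` for `ratHull α`, `lattice α`, `covol α ^ 2`, `const α`, and `e = d²
d!`, so `C = e D`. The `δ`-neighbourhood of an orbit of length `T` contains a translate of the image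
of the unit ball under the symmetric map `M z = δ z + β ⟨α, z⟩ α`, where `β |α| = T / 2`. So it is
enough that translates of this image by `Λ` cover `F`, that is, that `M⁻¹ Λ` has covering radius at
most `1`. By `transference`, the covering radius times the shortest length of a dual vector is at
most `(2 ^ d - 1) / 2 ≤ e / 2`. The dual of `M⁻¹ Λ` is `M Λ*`, and `|M k|` is at least both `δ |k|`
and `(T / 2) |k · α|`; hence the criterion `mem_denseTimes_of_dual`: one of the two must reach `e /
2` for every nonzero `k` in `Λ*`. The Gram determinant gives `D Λ* ⊆ Λ` (`covol_sq_smul_mem`). If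
`|D k| ≤ 2 C / δ`, then `Ψ` bounds `|D k · α|` from below and `T = C Ψ(2 C / δ)` is long enough;
otherwise `δ |k| > 2 e`. That `Λ` spans `F` and that `k · α ≠ 0` on `Λ \ {0}` both come from
`exists_rational_span_ratHull`. -/

theorem exists_shortest {E : Type*} [NormedAddCommGroup E] {L : Submodule ℤ E} (hL : ∀ R : ℝ, {x | x ∈ L ∧ ‖x‖ ≤ R}.Finite)
    {w : E} (hw : w ∈ L) (hw0 : w ≠ 0) :
    ∃ v ∈ L, v ≠ 0 ∧ ∀ x ∈ L, x ≠ 0 → ‖v‖ ≤ ‖x‖ := by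
  have hfin : {x | x ∈ L ∧ ‖x‖ ≤ ‖w‖ ∧ x ≠ 0}.Finite :=
    (hL ‖w‖).subset fun x hx => ⟨hx.1, hx.2.1⟩
  obtain ⟨v, ⟨hv, hvw, hv0⟩, hmin⟩ :=
    Set.exists_min_image _ (fun x => ‖x‖) hfin ⟨w, hw, le_rfl, hw0⟩
  refine ⟨v, hv, hv0, fun x hx hx0 => ?_⟩
  rcases le_total ‖x‖ ‖w‖ with h | h
  · exact hmin x ⟨hx, h, hx0⟩
  · exact hvw.trans h

variable {E : Type*} [NormedAddCommGroup E] [InnerProductSpace ℝ E]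

/-- The orthogonal projection along `v`, for `v ≠ 0`. -/
def projAlong (v : E) : E →ₗ[ℝ] E :=
  LinearMap.id - ((‖v‖ ^ 2)⁻¹ • (innerₛₗ ℝ v)).smulRight v

theorem projAlong_apply (v x : E) :
    projAlong v x = x - ((‖v‖ ^ 2)⁻¹ * inner ℝ v x) • v := by
  simp [projAlong]

theorem inner_projAlong {v : E} (hv : v ≠ 0) (x : E) : inner ℝ v (projAlong v x) = 0 := by
  have : ‖v‖ ≠ 0 := norm_ne_zero_iff.2 hv
  rw [projAlong_apply, inner_sub_right, inner_smul_right, real_inner_self_eq_norm_sq]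
  field_simp
  ring

/-- This makes a dual vector of the projected lattice a dual vector of the original lattice, so the
bound `r` is inherited in the induction. -/
theorem inner_projAlong_of_inner_eq_zero {v k : E} (hk : inner ℝ v k = 0) (x : E) :
    inner ℝ k (projAlong v x) = inner ℝ k x := by
  rw [projAlong_apply, inner_sub_right, inner_smul_right, real_inner_comm, real_inner_comm v k, hk]
  simp [real_inner_comm]

theorem exists_int_norm_sub_projAlong_le (v x : E) :
    ∃ m : ℤ, ‖x - m • v - projAlong v x‖ ≤ ‖v‖ / 2 := by
  set c := (‖v‖ ^ 2)⁻¹ * inner ℝ v x with hc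
  refine ⟨round c, ?_⟩
  have : x - round c • v - projAlong v x = (c - round c) • v := by
    rw [projAlong_apply, ← hc, sub_smul, Int.cast_smul_eq_zsmul]
    abel
  rw [this, norm_smul, Real.norm_eq_abs]
  have := abs_sub_round c
  nlinarith [norm_nonneg v]

/-- `L` projected along `v`. -/
def projLattice (L : Submodule ℤ E) (v : E) : Submodule ℤ E :=
  L.map ((projAlong v).restrictScalars ℤ)

theorem exists_lift_projLattice {L : Submodule ℤ E} {v : E} (hv : v ∈ L) {x : E}
    (hx : x ∈ projLattice L v) :
    ∃ u ∈ L, projAlong v u = x ∧ ‖u - x‖ ≤ ‖v‖ / 2 := by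
  obtain ⟨u, hu, rfl⟩ := hx
  obtain ⟨m, hm⟩ := exists_int_norm_sub_projAlong_le v u
  refine ⟨u - m • v, L.sub_mem hu (L.smul_mem m hv), ?_, hm⟩
  have : projAlong v v = 0 := by
    by_cases h : v = 0
    · simp [h]
    · have : ‖v‖ ≠ 0 := norm_ne_zero_iff.2 h
      rw [projAlong_apply, real_inner_self_eq_norm_sq, inv_mul_cancel₀ (by positivity)]
      simp
  simp [this]

/-- Short elements have short lifts, because a lift can be corrected by multiples of `v`. -/
theorem finite_projLattice {L : Submodule ℤ E} (hL : ∀ R : ℝ, {x | x ∈ L ∧ ‖x‖ ≤ R}.Finite)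
    {v : E} (hv : v ∈ L) (R : ℝ) : {x | x ∈ projLattice L v ∧ ‖x‖ ≤ R}.Finite := by
  refine ((hL (‖v‖ / 2 + R)).image (projAlong v)).subset ?_
  rintro x ⟨hx, hxR⟩
  obtain ⟨u, hu, hux, hd⟩ := exists_lift_projLattice hv hx
  refine ⟨u, ⟨hu, ?_⟩, hux⟩
  have := norm_add_le (u - x) x
  rw [sub_add_cancel] at this
  linarith

theorem inner_eq_zero_of_mem_span_projLattice {L : Submodule ℤ E} {v : E} (hv : v ≠ 0) {k : E}
    (hk : k ∈ Submodule.span ℝ (projLattice L v : Set E)) : inner ℝ v k = 0 := by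
  induction hk using Submodule.span_induction with
  | mem x hx =>
    obtain ⟨u, -, rfl⟩ := hx
    exact inner_projAlong hv u
  | zero => simp
  | add x y _ _ hx hy => rw [inner_add_right, hx, hy, add_zero]
  | smul c x _ hx => rw [inner_smul_right, hx, mul_zero]

theorem span_projLattice_le {L : Submodule ℤ E} {v : E} (hv : v ∈ L) :
    Submodule.span ℝ (projLattice L v : Set E) ≤ Submodule.span ℝ (L : Set E) := by
  rw [Submodule.span_le]
  rintro _ ⟨u, hu, rfl⟩
  simp only [LinearMap.coe_restrictScalars, projAlong_apply]
  exact Submodule.sub_mem _ (Submodule.subset_span hu)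
    (Submodule.smul_mem _ _ (Submodule.subset_span hv))

theorem projAlong_mem_span_projLattice {L : Submodule ℤ E} {v x : E}
    (hx : x ∈ Submodule.span ℝ (L : Set E)) :
    projAlong v x ∈ Submodule.span ℝ (projLattice L v : Set E) := by
  have := Submodule.mem_map_of_mem (f := projAlong v) hx
  rw [Submodule.map_span] at this
  exact this

/-- If a lattice lies on a line then the product of the lengths of the shortest vectors of the
lattice and of its dual is `1`. -/
theorem norm_le_of_projLattice_eq_bot {L : Submodule ℤ E} {v : E} (hv : v ∈ L) (hv0 : v ≠ 0)
    (hmin : ∀ x ∈ L, x ≠ 0 → ‖v‖ ≤ ‖x‖) (hbot : ∀ x ∈ projLattice L v, x = 0) {r : ℝ}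
    (hdual : ∀ k ∈ Submodule.span ℝ (L : Set E), k ≠ 0 →
      (∀ x ∈ L, ∃ m : ℤ, inner ℝ k x = (m : ℝ)) → r ≤ ‖k‖) :
    r * ‖v‖ ≤ 1 := by
  have hpos : 0 < ‖v‖ := norm_pos_iff.2 hv0
  -- The witness `v / |v|²` is dual because `L` is generated by `v`: a remainder of length at most
  -- `|v| / 2` must vanish by minimality.
  have key : r ≤ ‖(‖v‖ ^ 2)⁻¹ • v‖ := by
    refine hdual _ (Submodule.smul_mem _ _ (Submodule.subset_span hv))
      (smul_ne_zero (by positivity) hv0) fun x hx => ?_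
    obtain ⟨m, hm⟩ := exists_int_norm_sub_projAlong_le v x
    have hx0 : projAlong v x = 0 :=
      hbot _ (Submodule.mem_map_of_mem (f := (projAlong v).restrictScalars ℤ) hx)
    rw [hx0, sub_zero] at hm
    have h0 : x - m • v = 0 := by
      by_contra h0
      have := hmin _ (L.sub_mem hx (L.smul_mem m hv)) h0
      linarith
    refine ⟨m, ?_⟩
    rw [sub_eq_zero.1 h0, ← Int.cast_smul_eq_zsmul ℝ, inner_smul_left, inner_smul_right,
      real_inner_self_eq_norm_sq]
    simp only [map_inv₀, map_pow, conj_trivial]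
    field_simp
  rw [norm_smul, norm_inv, norm_pow, norm_norm] at key
  calc r * ‖v‖ ≤ ((‖v‖ ^ 2)⁻¹ * ‖v‖) * ‖v‖ := by gcongr
    _ = 1 := by field_simp

variable [FiniteDimensional ℝ E]

theorem finrank_span_projLattice_lt {L : Submodule ℤ E} {v : E} (hv : v ∈ L) (hv0 : v ≠ 0) :
    Module.finrank ℝ (Submodule.span ℝ (projLattice L v : Set E)) <
      Module.finrank ℝ (Submodule.span ℝ (L : Set E)) := by
  refine Submodule.finrank_lt_finrank_of_lt (lt_of_le_of_ne (span_projLattice_le hv) fun h => hv0 ?_)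
  have : v ∈ Submodule.span ℝ (projLattice L v : Set E) := h ▸ Submodule.subset_span hv
  exact inner_self_eq_zero.1 (inner_eq_zero_of_mem_span_projLattice hv0 this)

/-- Transference: if the non-zero vectors of the dual lattice have length at least `r`, then the
shortest vectors of the lattice and its covering radius are bounded in terms of `r⁻¹`. -/
theorem transference {r : ℝ} (hr : 0 ≤ r) (d : ℕ) (L : Submodule ℤ E)
    (hL : ∀ R : ℝ, {x | x ∈ L ∧ ‖x‖ ≤ R}.Finite)
    (hd : Module.finrank ℝ (Submodule.span ℝ (L : Set E)) ≤ d)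
    (hdual : ∀ k ∈ Submodule.span ℝ (L : Set E), k ≠ 0 →
      (∀ x ∈ L, ∃ m : ℤ, inner ℝ k x = (m : ℝ)) → r ≤ ‖k‖) :
    (∀ v ∈ L, v ≠ 0 → (∀ x ∈ L, x ≠ 0 → ‖v‖ ≤ ‖x‖) → r * ‖v‖ ≤ 2 ^ d / 2) ∧
      ∀ x ∈ Submodule.span ℝ (L : Set E), ∃ y ∈ L, r * ‖x - y‖ ≤ (2 ^ d - 1) / 2 := by
  induction d generalizing L with
  | zero =>
    have hbot : Submodule.span ℝ (L : Set E) = ⊥ :=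
      Submodule.finrank_eq_zero.1 (Nat.le_zero.1 hd)
    refine ⟨fun v hv hv0 => ?_, fun x hx => ⟨0, L.zero_mem, ?_⟩⟩
    · have := Submodule.subset_span (R := ℝ) hv
      rw [hbot] at this
      exact absurd ((Submodule.mem_bot ℝ).1 this) hv0
    · rw [hbot, Submodule.mem_bot] at hx
      simp [hx]
  | succ d ih =>
    have step : ∀ v ∈ L, v ≠ 0 →
        (∀ v' ∈ projLattice L v, v' ≠ 0 → (∀ x ∈ projLattice L v, x ≠ 0 → ‖v'‖ ≤ ‖x‖) →
          r * ‖v'‖ ≤ 2 ^ d / 2) ∧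
        ∀ x ∈ Submodule.span ℝ (projLattice L v : Set E), ∃ y ∈ projLattice L v,
          r * ‖x - y‖ ≤ (2 ^ d - 1) / 2 := by
      intro v hv hv0
      refine ih _ (finite_projLattice hL hv) ?_ fun k hk hk0 hint => ?_
      · have := finrank_span_projLattice_lt hv hv0
        omega
      · refine hdual k (span_projLattice_le hv hk) hk0 fun x hx => ?_
        rw [← inner_projAlong_of_inner_eq_zero (inner_eq_zero_of_mem_span_projLattice hv0 hk)]
        exact hint _ (Submodule.mem_map_of_mem (f := (projAlong v).restrictScalars ℤ) hx)
    have short : ∀ v ∈ L, v ≠ 0 → (∀ x ∈ L, x ≠ 0 → ‖v‖ ≤ ‖x‖) → r * ‖v‖ ≤ 2 ^ (d + 1) / 2 := by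
      intro v hv hv0 hmin
      by_cases hbot : ∀ x ∈ projLattice L v, x = 0
      · have h1 := norm_le_of_projLattice_eq_bot hv hv0 hmin hbot hdual
        have h2 : (1 : ℝ) ≤ 2 ^ d := one_le_pow₀ (by norm_num)
        rw [pow_succ]
        linarith
      · push Not at hbot
        obtain ⟨w, hw, hw0⟩ := hbot
        obtain ⟨v', hv', hv0', hmin'⟩ := exists_shortest (finite_projLattice hL hv) hw hw0
        have h1 := (step v hv hv0).1 v' hv' hv0' hmin'
        obtain ⟨u, hu, huv, hd'⟩ := exists_lift_projLattice hv hv'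
        have hu0 : u ≠ 0 := by
          rintro rfl
          exact hv0' (by simpa using huv.symm)
        have h2 := hmin u hu hu0
        have h3 := norm_add_le (u - v') v'
        rw [sub_add_cancel] at h3
        -- From `|v| ≤ |u| ≤ |v| / 2 + |v'|`: each dimension costs a factor `2`.
        have h4 : ‖v‖ ≤ 2 * ‖v'‖ := by linarith
        have h5 := mul_le_mul_of_nonneg_left h4 hr
        rw [pow_succ]
        linarith
    refine ⟨short, fun x hx => ?_⟩
    by_cases hbot : ∀ w ∈ L, w = 0
    · refine ⟨0, L.zero_mem, ?_⟩
      have hx0 : x = 0 := by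
        have : Submodule.span ℝ (L : Set E) ≤ ⊥ :=
          Submodule.span_le.2 fun w hw => by simp [hbot w hw]
        simpa using this hx
      have h2 : (1 : ℝ) ≤ 2 ^ (d + 1) := one_le_pow₀ (by norm_num)
      simp only [hx0, sub_zero, norm_zero, mul_zero]
      linarith
    · push Not at hbot
      obtain ⟨w, hw, hw0⟩ := hbot
      obtain ⟨v, hv, hv0, hmin⟩ := exists_shortest hL hw hw0
      obtain ⟨y, hy, hxy⟩ := (step v hv hv0).2 _ (projAlong_mem_span_projLattice hx)
      obtain ⟨u, hu, rfl⟩ := hy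
      rw [LinearMap.coe_restrictScalars, ← map_sub] at hxy
      obtain ⟨m, hm⟩ := exists_int_norm_sub_projAlong_le v (x - u)
      refine ⟨u + m • v, L.add_mem hu (L.smul_mem m hv), ?_⟩
      -- The error splits into a part along `v`, at most `|v| / 2`, and the projected error; times
      -- `r` they add up to `2 ^ d / 2 + (2 ^ d - 1) / 2`.
      have h1 := norm_add_le (x - u - m • v - projAlong v (x - u)) (projAlong v (x - u))
      rw [sub_add_cancel, sub_sub x] at h1
      have h2 := short v hv hv0 hmin
      have h3 : ‖x - (u + m • v)‖ ≤ ‖v‖ / 2 + ‖projAlong v (x - u)‖ := by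
        rw [sub_sub x] at hm
        linarith
      have h4 := mul_le_mul_of_nonneg_left h3 hr
      rw [pow_succ] at h2 ⊢
      linarith

/-- Covering by the image of a ball under a symmetric map, in terms of the dual lattice. -/
theorem exists_add_map_of_dual {r : ℝ} (hr : 0 ≤ r) (L : Submodule ℤ E)
    (hL : ∀ R : ℝ, {x | x ∈ L ∧ ‖x‖ ≤ R}.Finite) (hspan : Submodule.span ℝ (L : Set E) = ⊤)
    (M : E ≃ₗ[ℝ] E) (hM : ∀ x y, inner ℝ (M x) y = inner ℝ x (M y))
    (hdual : ∀ k : E, k ≠ 0 → (∀ x ∈ L, ∃ m : ℤ, inner ℝ k x = (m : ℝ)) → r ≤ ‖M k‖) (x : E) :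
    ∃ y ∈ L, ∃ z, x = y + M z ∧ r * ‖z‖ ≤ (2 ^ Module.finrank ℝ E - 1) / 2 := by
  set L' : Submodule ℤ E := L.comap ((M : E →ₗ[ℝ] E).restrictScalars ℤ) with hL'
  have hmem : ∀ z, z ∈ L' ↔ M z ∈ L := fun z => Iff.rfl
  have hspan' : Submodule.span ℝ (L' : Set E) = ⊤ := by
    have himg : (L' : Set E) = (M.symm : E →ₗ[ℝ] E) '' (L : Set E) := by
      ext z
      simp only [SetLike.mem_coe, hmem, Set.mem_image, LinearEquiv.coe_coe]
      exact ⟨fun h => ⟨M z, h, by simp⟩, by rintro ⟨w, hw, rfl⟩; simpa using hw⟩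
    rw [himg, ← Submodule.map_span, hspan, Submodule.map_top, LinearEquiv.range]
  have hfin : ∀ R : ℝ, {x | x ∈ L' ∧ ‖x‖ ≤ R}.Finite := by
    intro R
    set f : E →L[ℝ] E := LinearMap.toContinuousLinearMap (M : E →ₗ[ℝ] E) with hf
    refine Set.Finite.of_finite_image ((hL (‖f‖ * R)).subset ?_) M.injective.injOn
    rintro _ ⟨z, ⟨hz, hzR⟩, rfl⟩
    refine ⟨hz, ?_⟩
    calc ‖M z‖ = ‖f z‖ := rfl
      _ ≤ ‖f‖ * ‖z‖ := f.le_opNorm z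
      _ ≤ ‖f‖ * R := by gcongr
  have htr := (transference hr (Module.finrank ℝ E) L' hfin (Submodule.finrank_le _) ?_).2
    (M.symm x) (hspan' ▸ Submodule.mem_top)
  · obtain ⟨y, hy, h⟩ := htr
    exact ⟨M y, hy, M.symm x - y, by simp, h⟩
  -- Since `M` is symmetric, `M⁻¹ k` is dual to `L` whenever `k` is dual to `M⁻¹ L`.
  · intro k _ hk0 hint
    have := hdual (M.symm k) (by simpa using hk0) fun y hy => by
      obtain ⟨m, hm⟩ := hint (M.symm y) ((hmem _).2 (by simpa using hy))
      refine ⟨m, ?_⟩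
      rw [← hm, ← M.apply_symm_apply y, ← hM]
      simp
    simpa using this

end Covering

/-! ### Rational subspaces and the rational hull -/

variable {n : ℕ}

theorem isRational_span {s : Set (EuclideanSpace ℝ (Fin n))}
    (hs : ∀ v ∈ s, ∀ i, ∃ q : ℚ, v i = (q : ℝ)) : IsRational (Submodule.span ℝ s) := by
  obtain ⟨b, hbs, hspan, hli⟩ := exists_linearIndependent ℝ s
  exact ⟨b, fun v hv => hs v (hbs hv), hli, hspan⟩

theorem exists_projection_matrix (W : Submodule ℚ (Fin n → ℚ)) :
    ∃ S : Matrix (Fin n) (Fin n) ℚ, (∀ w ∈ W, S.mulVec w = w) ∧ ∀ x, S.mulVec x ∈ W := by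
  obtain ⟨g, hg⟩ := LinearMap.exists_leftInverse_of_injective W.subtype
    (LinearMap.ker_eq_bot.2 W.injective_subtype)
  refine ⟨LinearMap.toMatrix' (W.subtype ∘ₗ g), fun w hw => ?_, fun x => ?_⟩
  · rw [LinearMap.toMatrix'_mulVec]
    have := LinearMap.congr_fun hg ⟨w, hw⟩
    simp only [LinearMap.comp_apply, Submodule.subtype_apply, LinearMap.id_apply] at this
    simp [this]
  · rw [LinearMap.toMatrix'_mulVec]
    exact (g x).2

/-- The real matrix with the given rational entries. -/
abbrev realMatrix (S : Matrix (Fin n) (Fin n) ℚ) : Matrix (Fin n) (Fin n) ℝ :=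
  S.map (Rat.castHom ℝ)

theorem mulVec_eq_sum_col (R : Matrix (Fin n) (Fin n) ℝ) (x : Fin n → ℝ) :
    WithLp.toLp 2 (R.mulVec x) = ∑ j, x j • (WithLp.toLp 2 (R.col j) : EuclideanSpace ℝ (Fin n)) := by
  ext i
  simp [Matrix.mulVec, dotProduct, mul_comm]

/-- A rational subspace is the range of a projection with rational matrix. -/
theorem IsRational.exists_matrix {V : Submodule ℝ (EuclideanSpace ℝ (Fin n))} (hV : IsRational V) :
    ∃ S : Matrix (Fin n) (Fin n) ℚ,
      (∀ x ∈ V, (realMatrix S).mulVec (WithLp.ofLp x) = WithLp.ofLp x) ∧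
      ∀ x, WithLp.toLp 2 ((realMatrix S).mulVec x) ∈ V := by
  obtain ⟨s, hs, -, rfl⟩ := hV
  set emb : (Fin n → ℚ) → EuclideanSpace ℝ (Fin n) :=
    fun q => WithLp.toLp 2 (fun i => (q i : ℝ)) with hemb
  obtain ⟨S, hS1, hS2⟩ := exists_projection_matrix (Submodule.span ℚ (emb ⁻¹' s))
  have hU : ∀ u ∈ Submodule.span ℚ (emb ⁻¹' s), emb u ∈ Submodule.span ℝ s := by
    intro u hu
    induction hu using Submodule.span_induction with
    | mem x hx => exact Submodule.subset_span hx
    | zero =>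
      convert Submodule.zero_mem _
      ext i
      simp [hemb]
    | add x y _ _ hx hy =>
      convert Submodule.add_mem _ hx hy
      ext i
      simp [hemb]
    | smul c x _ hx =>
      convert Submodule.smul_mem _ (c : ℝ) hx
      ext i
      simp [hemb]
  refine ⟨S, fun x hx => ?_, fun x => ?_⟩
  · induction hx using Submodule.span_induction with
    | mem x hx =>
      choose q hq using hs x hx
      have hxq : x = emb q := by
        ext i
        simp [hemb, hq]
      have := hS1 q (Submodule.subset_span (by simpa [← hxq] using hx))
      ext i
      have h1 := RingHom.map_mulVec (Rat.castHom ℝ) S q i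
      rw [this] at h1
      rw [hxq]
      exact h1.symm
    | zero => simp
    | add x y _ _ hx hy => rw [WithLp.ofLp_add, Matrix.mulVec_add, hx, hy]
    | smul c x _ hx => rw [WithLp.ofLp_smul, Matrix.mulVec_smul, hx]
  · rw [mulVec_eq_sum_col]
    refine Submodule.sum_mem _ fun j _ => Submodule.smul_mem _ _ ?_
    have := hU _ (hS2 (Pi.single j 1))
    convert this using 1
    ext i
    simp [hemb, Matrix.mulVec_single]

/-- The rational hull is spanned by vectors with rational components. -/
theorem exists_rational_span_ratHull (α : EuclideanSpace ℝ (Fin n)) :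
    ∃ c : Fin n → EuclideanSpace ℝ (Fin n), (∀ j i, ∃ q : ℚ, c j i = (q : ℝ)) ∧
      Submodule.span ℝ (Set.range c) = ratHull α ∧
      ∀ w : Fin n → ℚ, ∑ i, (w i : ℝ) * α i = 0 → ∀ j, ∑ i, (w i : ℝ) * c j i = 0 := by
  set W : Submodule ℚ (Fin n → ℚ) :=
    { carrier := {q | ∑ i, (q i : ℝ) * α i = 0}
      zero_mem' := by simp
      add_mem' := by
        intro a b ha hb
        simp only [Set.mem_ofPred_eq] at ha hb ⊢
        simp [add_mul, Finset.sum_add_distrib, ha, hb]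
      smul_mem' := by
        intro c a ha
        simp only [Set.mem_ofPred_eq] at ha ⊢
        simp [mul_assoc, ← Finset.mul_sum, ha] } with hW
  have hWmem : ∀ q, q ∈ W ↔ ∑ i, (q i : ℝ) * α i = 0 := fun q => Iff.rfl
  obtain ⟨S, hS1, hS2⟩ := exists_projection_matrix W
  -- `W` is the space of rational relations of `α` and `S` projects onto it. Hence `W` annihilates
  -- the columns of `P`, while `Sᵀ α = 0` gives `P α = α`.
  set P : Matrix (Fin n) (Fin n) ℚ := 1 - S.transpose with hP
  have hcol : ∀ j, ∀ w ∈ W, ∑ i, w i * P i j = 0 := by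
    intro j w hw
    have := congrFun (hS1 w hw) j
    simp only [Matrix.mulVec, dotProduct] at this
    simp only [hP, Matrix.sub_apply, Matrix.transpose_apply, mul_sub, Finset.sum_sub_distrib]
    simp only [mul_comm (w _)] at *
    rw [this]
    simp [Matrix.one_apply]
  have hPα : (realMatrix P).mulVec (WithLp.ofLp α) = WithLp.ofLp α := by
    have hSα : (realMatrix S.transpose).mulVec (WithLp.ofLp α) = 0 := by
      ext j
      have := (hWmem _).1 (hS2 (Pi.single j 1))
      simpa [Matrix.mulVec, dotProduct, Pi.single_apply] using this
    have : realMatrix P = 1 - realMatrix S.transpose := by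
      rw [hP]
      ext i j
      by_cases h : i = j <;> simp [h]
    rw [this, Matrix.sub_mulVec, hSα, Matrix.one_mulVec, sub_zero]
  refine ⟨fun j => WithLp.toLp 2 ((realMatrix P).col j), fun j i => ⟨P i j, by simp⟩,
    le_antisymm ?_ ?_, fun w hw j => ?_⟩
  · rw [Submodule.span_le]
    rintro _ ⟨j, rfl⟩
    refine Submodule.mem_sInf.2 ?_
    rintro V ⟨hV, hαV⟩
    obtain ⟨R, hR1, hR2⟩ := hV.exists_matrix
    -- As `R α = α`, the rows of `1 - R` are relations of `α`; they kill the columns of `P`, which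
    -- are therefore fixed by `R` and lie in `V`.
    have hrow : ∀ i, (fun l => (1 - R) i l) ∈ W := by
      intro i
      rw [hWmem]
      have := congrFun (hR1 α hαV) i
      simp only [Matrix.mulVec, dotProduct, Matrix.map_apply, Rat.coe_castHom] at this
      simp only [Matrix.sub_apply, Rat.cast_sub, sub_mul, Finset.sum_sub_distrib, this]
      rw [Finset.sum_eq_single i] <;> simp +contextual [eq_comm]
    have : (realMatrix P).col j = (realMatrix R).mulVec ((realMatrix P).col j) := by
      ext i
      have h := hcol j _ (hrow i)
      simp only [Matrix.sub_apply, sub_mul, Finset.sum_sub_distrib, Matrix.one_apply, ite_mul,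
        one_mul, zero_mul, Finset.sum_ite_eq, Finset.mem_univ, if_true, sub_eq_zero] at h
      simp [Matrix.mulVec, dotProduct, h]
    have hmem := hR2 ((realMatrix P).col j)
    rwa [← this] at hmem
  · refine sInf_le ⟨isRational_span ?_, ?_⟩
    · rintro _ ⟨j, rfl⟩ i
      exact ⟨P i j, by simp⟩
    · have : α = WithLp.toLp 2 ((realMatrix P).mulVec (WithLp.ofLp α)) := by rw [hPα]
      rw [this, mulVec_eq_sum_col]
      exact Submodule.sum_mem _ fun j _ => Submodule.smul_mem _ _
        (Submodule.subset_span ⟨j, rfl⟩)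
  · have := hcol j w hw
    simp only [Matrix.col_apply, Matrix.map_apply, Rat.coe_castHom]
    exact_mod_cast this

/-- Clear denominators in the rational spanning vectors. -/
theorem span_lattice (α : EuclideanSpace ℝ (Fin n)) :
    Submodule.span ℝ (lattice α : Set (ratHull α)) = ⊤ := by
  obtain ⟨c, hc, hspan, -⟩ := exists_rational_span_ratHull α
  have hmem : ∀ j, c j ∈ ratHull α := fun j => hspan ▸ Submodule.subset_span ⟨j, rfl⟩
  suffices h : ratHull α ≤
      (Submodule.span ℝ (lattice α : Set (ratHull α))).map (ratHull α).subtype by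
    rw [eq_top_iff]
    rintro ⟨x, hx⟩ -
    obtain ⟨y, hy, hyx⟩ := h hx
    have : y = ⟨x, hx⟩ := Subtype.ext hyx
    exact this ▸ hy
  conv_lhs => rw [← hspan]
  rw [Submodule.span_le]
  rintro _ ⟨j, rfl⟩
  refine ⟨⟨c j, hmem j⟩, ?_, rfl⟩
  choose q hq using hc j
  set N : ℕ := ∏ i, (q i).den with hN
  have hN0 : (N : ℝ) ≠ 0 := by
    simp [hN, Finset.prod_eq_zero_iff]
  have hlat : (N : ℝ) • (⟨c j, hmem j⟩ : ratHull α) ∈ lattice α := by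
    intro i
    obtain ⟨k, hk⟩ : (q i).den ∣ N := Finset.dvd_prod_of_mem _ (Finset.mem_univ i)
    refine ⟨k * (q i).num, ?_⟩
    have h1 : ((q i).den : ℝ) * (q i : ℝ) = (q i).num := by
      exact_mod_cast Rat.den_mul_eq_num (q i)
    simp only [Submodule.coe_smul, PiLp.smul_apply, smul_eq_mul, hq, hk]
    push_cast
    rw [← h1]
    ring
  have := Submodule.smul_mem _ (N : ℝ)⁻¹ (Submodule.subset_span (R := ℝ) hlat)
  rwa [smul_smul, inv_mul_cancel₀ hN0, one_smul] at this

/-- The integer vectors of the rational hull are not orthogonal to `α`. -/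
theorem sum_mul_ne_zero {α : EuclideanSpace ℝ (Fin n)} {k : ratHull α} (hk : k ∈ lattice α)
    (hk0 : k ≠ 0) : ∑ i, (k : EuclideanSpace ℝ (Fin n)) i * α i ≠ 0 := by
  intro h
  obtain ⟨c, -, hspan, hc⟩ := exists_rational_span_ratHull α
  choose m hm using hk
  have hα := hc (fun i => (m i : ℚ)) (by simpa [hm] using h)
  -- A rational relation of `α` holds on the whole hull, so `k` would be orthogonal to itself.
  have hperp : ∀ x ∈ ratHull α, inner ℝ (k : EuclideanSpace ℝ (Fin n)) x = 0 := by
    intro x hx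
    rw [← hspan] at hx
    induction hx using Submodule.span_induction with
    | mem x hx =>
      obtain ⟨j, rfl⟩ := hx
      simpa [PiLp.inner_apply, hm, mul_comm] using hα j
    | zero => simp
    | add x y _ _ hx hy => rw [inner_add_right, hx, hy, add_zero]
    | smul c x _ hx => rw [inner_smul_right, hx, mul_zero]
  exact hk0 (Subtype.ext (inner_self_eq_zero.1 (hperp k k.2)))

/-! ### The max norm and discreteness of the lattice -/

theorem maxNorm_nonneg (x : EuclideanSpace ℝ (Fin n)) : 0 ≤ maxNorm x := norm_nonneg _

theorem abs_apply_le_maxNorm (x : EuclideanSpace ℝ (Fin n)) (i : Fin n) : |x i| ≤ maxNorm x :=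
  norm_le_pi_norm (WithLp.ofLp x) i

theorem maxNorm_le_norm (x : EuclideanSpace ℝ (Fin n)) : maxNorm x ≤ ‖x‖ :=
  (pi_norm_le_iff_of_nonneg (norm_nonneg x)).2 fun i => PiLp.norm_apply_le x i

theorem maxNorm_add_le (x y : EuclideanSpace ℝ (Fin n)) :
    maxNorm (x + y) ≤ maxNorm x + maxNorm y :=
  norm_add_le (WithLp.ofLp x) (WithLp.ofLp y)

theorem maxNorm_smul (c : ℝ) (x : EuclideanSpace ℝ (Fin n)) :
    maxNorm (c • x) = |c| * maxNorm x :=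
  norm_smul c (WithLp.ofLp x)

theorem maxNorm_pos {x : EuclideanSpace ℝ (Fin n)} (hx : x ≠ 0) : 0 < maxNorm x := by
  refine norm_pos_iff.2 fun h => hx ?_
  ext i
  simpa using congrFun h i

theorem one_le_maxNorm {α : EuclideanSpace ℝ (Fin n)} {k : ratHull α} (hk : k ∈ lattice α)
    (hk0 : k ≠ 0) : 1 ≤ maxNorm (k : EuclideanSpace ℝ (Fin n)) := by
  obtain ⟨i, hi⟩ : ∃ i, (k : EuclideanSpace ℝ (Fin n)) i ≠ 0 := by
    by_contra! h
    exact hk0 (Subtype.ext (by ext i; simpa using h i))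
  obtain ⟨m, hm⟩ := hk i
  refine le_trans ?_ (abs_apply_le_maxNorm _ i)
  have hm0 : m ≠ 0 := by
    rintro rfl
    exact hi (by simpa using hm)
  have h1 : (1 : ℝ) ≤ |(m : ℝ)| := by exact_mod_cast Int.one_le_abs hm0
  exact hm ▸ h1

instance discreteTopology_lattice (α : EuclideanSpace ℝ (Fin n)) :
    DiscreteTopology (lattice α) := by
  refine DiscreteTopology.of_forall_le_dist one_pos fun x y hxy => ?_
  have h := one_le_maxNorm (lattice α |>.sub_mem x.2 y.2)
    (fun h => hxy (Subtype.ext (sub_eq_zero.1 h)))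
  change 1 ≤ dist x y
  rw [Subtype.dist_eq, dist_eq_norm]
  exact h.trans (maxNorm_le_norm _)

instance isZLattice_lattice (α : EuclideanSpace ℝ (Fin n)) : IsZLattice ℝ (lattice α) :=
  ⟨span_lattice α⟩

theorem finite_lattice (α : EuclideanSpace ℝ (Fin n)) (R : ℝ) :
    {x | x ∈ lattice α ∧ ‖x‖ ≤ R}.Finite := by
  have hd : DiscreteTopology (lattice α).toAddSubgroup := discreteTopology_lattice α
  have hclosed : IsClosed ((lattice α).toAddSubgroup : Set (ratHull α)) :=
    AddSubgroup.isClosed_of_discrete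
  refine (Metric.finite_isBounded_inter_isClosed (K := Metric.closedBall 0 R)
    (DiscreteTopology.isDiscrete (s := ((lattice α) : Set (ratHull α))))
    Metric.isBounded_closedBall hclosed).subset ?_
  rintro x ⟨hx, hxR⟩
  exact ⟨by simpa using hxR, hx⟩

/-! ### Gram determinants and the dual lattice -/

section Gram

variable {E : Type*} [NormedAddCommGroup E] [InnerProductSpace ℝ E] [FiniteDimensional ℝ E]
  {ι : Type*} [Fintype ι] [DecidableEq ι]

/-- The square of the covolume of a lattice is the Gram determinant of a basis. -/
theorem covolume_sq_eq_det_gram [MeasurableSpace E] [BorelSpace E] (L : Submodule ℤ E)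
    [DiscreteTopology L] [IsZLattice ℝ L] (b : Module.Basis ι ℤ L) :
    ZLattice.covolume L volume ^ 2 =
      (Matrix.of fun i j => inner ℝ (b i : E) (b j : E)).det := by
  have hcard : Module.finrank ℝ E = Fintype.card ι :=
    Module.finrank_eq_card_basis (b.ofZLatticeBasis ℝ L)
  set b₀ : OrthonormalBasis ι ℝ E := (stdOrthonormalBasis ℝ E).reindex
    (Fintype.equivOfCardEq (by simp [hcard])) with hb₀
  have hvol : (volume : Measure E).real (ZSpan.fundamentalDomain b₀.toBasis) = 1 := by
    rw [measureReal_congr (ZSpan.fundamentalDomain_ae_parallelepiped b₀.toBasis volume)]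
    simp [Measure.real, b₀.volume_parallelepiped]
  rw [ZLattice.covolume_eq_det_mul_measureReal L volume b b₀.toBasis, hvol, mul_one, sq_abs]
  have hG : (Matrix.of fun i j => inner ℝ (b i : E) (b j : E)) =
      (b₀.toBasis.toMatrix ((↑) ∘ b)).transpose * b₀.toBasis.toMatrix ((↑) ∘ b) := by
    ext i j
    simp only [Matrix.of_apply, Matrix.mul_apply, Matrix.transpose_apply, Module.Basis.toMatrix_apply,
      OrthonormalBasis.coe_toBasis_repr_apply, OrthonormalBasis.repr_apply_apply, Function.comp]
    rw [← b₀.sum_inner_mul_inner]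
    simp only [real_inner_comm]
  rw [hG, Matrix.det_mul, Matrix.det_transpose, Module.Basis.det_apply, sq]

/-- For an integral lattice, the Gram determinant maps the dual lattice into the lattice. -/
theorem det_gram_smul_mem (L : Submodule ℤ E)
    [DiscreteTopology L] [IsZLattice ℝ L] (b : Module.Basis ι ℤ L)
    (hL : ∀ x ∈ L, ∀ y ∈ L, ∃ m : ℤ, inner ℝ x y = (m : ℝ)) {k : E}
    (hk : ∀ x ∈ L, ∃ m : ℤ, inner ℝ k x = (m : ℝ)) :
    (Matrix.of fun i j => inner ℝ (b i : E) (b j : E)).det • k ∈ L := by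
  set G := Matrix.of fun i j => inner ℝ (b i : E) (b j : E) with hG
  choose g hg using fun i j => hL (b i) (b i).2 (b j) (b j).2
  choose m hm using fun i => hk (b i) (b i).2
  set x := (b.ofZLatticeBasis ℝ L).repr k with hx
  have hkx : k = ∑ j, x j • (b j : E) := by
    conv_lhs => rw [← (b.ofZLatticeBasis ℝ L).sum_repr k]
    simp [hx]
  have hGm : G.mulVec x = fun i => (m i : ℝ) := by
    ext i
    rw [← hm i, hkx, sum_inner]
    simp [Matrix.mulVec, dotProduct, hG, inner_smul_left, real_inner_comm, mul_comm]
  have hGg : G = (Matrix.of g).map (Int.castRingHom ℝ) := by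
    ext i j
    simp [hG, hg]
  -- Cramer's rule: `G x = m` with `G` and `m` integral, so `det G • x = adj(G) m` is integral.
  have hdet : G.det • (x : ι → ℝ) =
      fun i => ((((Matrix.of g).adjugate.mulVec m) i : ℤ) : ℝ) := by
    have h1 : G.adjugate.mulVec (G.mulVec x) = G.det • (x : ι → ℝ) := by
      rw [Matrix.mulVec_mulVec, Matrix.adjugate_mul, Matrix.smul_mulVec, Matrix.one_mulVec]
    rw [← h1, hGm, hGg]
    ext i
    have h2 := RingHom.map_mulVec (Int.castRingHom ℝ) (Matrix.of g).adjugate m i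
    rw [← RingHom.mapMatrix_apply, RingHom.map_adjugate] at h2
    exact h2.symm
  have : G.det • k = ∑ j, ((Matrix.of g).adjugate.mulVec m) j • (b j : E) := by
    rw [hkx, Finset.smul_sum]
    refine Finset.sum_congr rfl fun j _ => ?_
    rw [smul_smul, ← Int.cast_smul_eq_zsmul ℝ]
    exact congrArg (· • (b j : E)) (congrFun hdet j)
  rw [this]
  exact L.sum_mem fun j _ => L.smul_mem _ (b j).2

end Gram

theorem inner_eq_sum (x y : EuclideanSpace ℝ (Fin n)) : inner ℝ x y = ∑ i, x i * y i := by
  simp [PiLp.inner_apply, mul_comm]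

theorem exists_int_inner_lattice {α : EuclideanSpace ℝ (Fin n)} {x y : ratHull α}
    (hx : x ∈ lattice α) (hy : y ∈ lattice α) : ∃ m : ℤ, inner ℝ x y = (m : ℝ) := by
  choose a ha using hx
  choose b hb using hy
  exact ⟨∑ i, a i * b i, by simp [Submodule.coe_inner, inner_eq_sum, ha, hb]⟩

theorem covol_sq_smul_mem (α : EuclideanSpace ℝ (Fin n)) {k : ratHull α}
    (hk : ∀ x ∈ lattice α, ∃ m : ℤ, inner ℝ k x = (m : ℝ)) :
    covol α ^ 2 • k ∈ lattice α := by
  classical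
  have := ZLattice.module_free ℝ (lattice α)
  have := ZLattice.module_finite ℝ (lattice α)
  rw [covol, covolume_sq_eq_det_gram (lattice α) (Module.Free.chooseBasis ℤ (lattice α))]
  exact det_gram_smul_mem _ _ (fun x hx y hy => exists_int_inner_lattice hx hy) hk

theorem covol_pos (α : EuclideanSpace ℝ (Fin n)) : 0 < covol α := ZLattice.covolume_pos _ _

theorem Psi_nonneg (α : EuclideanSpace ℝ (Fin n)) (Q : ℝ) : 0 ≤ Psi α Q := by
  refine Real.sSup_nonneg ?_
  rintro _ ⟨k, -, -, -, rfl⟩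
  positivity

theorem norm_le_sqrt_mul_maxNorm (x : EuclideanSpace ℝ (Fin n)) :
    ‖x‖ ≤ √n * maxNorm x := by
  rw [EuclideanSpace.norm_eq, ← Real.sqrt_sq (maxNorm_nonneg x), ← Real.sqrt_mul (by positivity)]
  refine Real.sqrt_le_sqrt ?_
  calc ∑ i, ‖x i‖ ^ 2 ≤ ∑ _i : Fin n, maxNorm x ^ 2 :=
        Finset.sum_le_sum fun i _ => by gcongr; exact abs_apply_le_maxNorm x i
    _ = n * maxNorm x ^ 2 := by simp

theorem inv_abs_le_Psi {α : EuclideanSpace ℝ (Fin n)} {k : ratHull α} (hk : k ∈ lattice α)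
    (hk0 : k ≠ 0) {Q : ℝ} (hkQ : maxNorm (k : EuclideanSpace ℝ (Fin n)) ≤ Q) :
    |∑ i, (k : EuclideanSpace ℝ (Fin n)) i * α i|⁻¹ ≤ Psi α Q := by
  refine le_csSup ?_ ⟨k, hk, maxNorm_pos (by simpa using hk0), hkQ, rfl⟩
  refine (((finite_lattice α (√n * Q)).image
    fun k : ratHull α => |∑ i, (k : EuclideanSpace ℝ (Fin n)) i * α i|⁻¹).subset ?_).bddAbove
  rintro _ ⟨l, hl, -, hlQ, rfl⟩
  refine ⟨l, ⟨hl, ?_⟩, rfl⟩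
  calc ‖l‖ = ‖(l : EuclideanSpace ℝ (Fin n))‖ := rfl
    _ ≤ √n * maxNorm (l : EuclideanSpace ℝ (Fin n)) := norm_le_sqrt_mul_maxNorm _
    _ ≤ √n * Q := by gcongr

/-! ### Distance on the torus and attainment of the ergodization time -/

theorem flow_zero (α : EuclideanSpace ℝ (Fin n)) (t : ℝ) :
    flow α t 0 = (lattice α).mkQ (t • ⟨α, mem_ratHull α⟩) := by
  rw [flow, zero_add]

theorem torusDist_le {α : EuclideanSpace ℝ (Fin n)} {θ θ' : Torus α} {x : ratHull α}
    (hx : (lattice α).mkQ x = θ - θ') :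
    torusDist θ θ' ≤ maxNorm (x : EuclideanSpace ℝ (Fin n)) := by
  refine csInf_le ⟨0, ?_⟩ ⟨x, hx, rfl⟩
  rintro _ ⟨y, -, rfl⟩
  exact maxNorm_nonneg _

theorem torusDist_flow_le (α : EuclideanSpace ℝ (Fin n)) (θ : Torus α) (s t : ℝ) :
    torusDist θ (flow α s 0) ≤ torusDist θ (flow α t 0) + maxNorm α * |s - t| := by
  rw [← sub_le_iff_le_add]
  refine le_csInf ?_ ?_
  · obtain ⟨x, hx⟩ := (lattice α).mkQ_surjective (θ - flow α t 0)
    exact ⟨_, x, hx, rfl⟩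
  · rintro _ ⟨x, hx, rfl⟩
    rw [sub_le_iff_le_add]
    have h : torusDist θ (flow α s 0) ≤
        maxNorm ((x + (t - s) • ⟨α, mem_ratHull α⟩ : ratHull α) : EuclideanSpace ℝ (Fin n)) := by
      refine torusDist_le ?_
      rw [map_add, hx, flow_zero, flow_zero, sub_smul, map_sub]
      abel
    refine h.trans ((maxNorm_add_le _ _).trans ?_)
    rw [Submodule.coe_smul, maxNorm_smul, abs_sub_comm, mul_comm]

theorem continuous_torusDist_flow (α : EuclideanSpace ℝ (Fin n)) (θ : Torus α) :
    Continuous fun t => torusDist θ (flow α t 0) := by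
  refine (LipschitzWith.of_le_add_mul ⟨maxNorm α, maxNorm_nonneg α⟩ fun s t => ?_).continuous
  exact torusDist_flow_le α θ s t

/-- If some piece of orbit is `δ`-dense then the ergodization time is attained. -/
theorem isLeast_ergodizationTime {α : EuclideanSpace ℝ (Fin n)} {δ : ℝ}
    (hne : (denseTimes α δ).Nonempty) : IsLeast (denseTimes α δ) (ergodizationTime α δ) := by
  have hbdd : BddBelow (denseTimes α δ) := ⟨0, fun T hT => hT.1⟩
  refine ⟨⟨le_csInf hne fun T hT => hT.1, fun θ => ?_⟩, fun T hT => csInf_le hbdd hT⟩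
  set A : Set ℝ := {t | 0 ≤ t ∧ torusDist θ (flow α t 0) ≤ δ} with hA
  have hAclosed : IsClosed A :=
    isClosed_Ici.inter (isClosed_Iic.preimage (continuous_torusDist_flow α θ))
  have hAbdd : BddBelow A := ⟨0, fun t ht => ht.1⟩
  have hex : ∀ T ∈ denseTimes α δ, ∃ t ∈ A, t ≤ T := by
    rintro T ⟨-, hT⟩
    obtain ⟨_, ⟨t, ht0, htT, rfl⟩, hd⟩ := hT θ
    exact ⟨t, ⟨ht0, hd⟩, htT⟩
  have hAne : A.Nonempty := by
    obtain ⟨T, hT⟩ := hne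
    obtain ⟨t, ht, -⟩ := hex T hT
    exact ⟨t, ht⟩
  -- The first time the orbit comes within `δ` of `θ` is attained, and it precedes every `T` in
  -- `denseTimes α δ`, hence their infimum.
  have hmem : sInf A ∈ A := hAclosed.csInf_mem hAne hAbdd
  refine ⟨_, ⟨sInf A, hmem.1, le_csInf hne fun T hT => ?_, rfl⟩, hmem.2⟩
  obtain ⟨t, ht, htT⟩ := hex T hT
  exact (csInf_le hAbdd ht).trans htT

/-! ### The stretched ball and the density criterion -/

section Stretch

variable {E : Type*} [NormedAddCommGroup E] [InnerProductSpace ℝ E]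

/-- The symmetric map `z ↦ δ z + β ⟨a, z⟩ a`. -/
def stretchMap (δ β : ℝ) (a : E) : E →ₗ[ℝ] E :=
  δ • LinearMap.id + (β • innerₛₗ ℝ a).smulRight a

theorem stretchMap_apply (δ β : ℝ) (a z : E) :
    stretchMap δ β a z = δ • z + (β * inner ℝ a z) • a := by
  simp [stretchMap]

theorem inner_stretchMap (δ β : ℝ) (a x y : E) :
    inner ℝ (stretchMap δ β a x) y = inner ℝ x (stretchMap δ β a y) := by
  simp only [stretchMap_apply, inner_add_left, inner_add_right, inner_smul_left, inner_smul_right,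
    conj_trivial, real_inner_comm a]
  ring

/-- For `δ, β ≥ 0` all three terms are nonnegative; keeping only the first or only the last gives
the two lower bounds that follow. -/
theorem norm_sq_stretchMap (δ β : ℝ) (a z : E) :
    ‖stretchMap δ β a z‖ ^ 2 =
      (δ * ‖z‖) ^ 2 + 2 * δ * β * inner ℝ a z ^ 2 + (β * ‖a‖ * inner ℝ a z) ^ 2 := by
  rw [stretchMap_apply, norm_add_sq_real, norm_smul, norm_smul, inner_smul_left, inner_smul_right,
    real_inner_comm a z, Real.norm_eq_abs, Real.norm_eq_abs, mul_pow, mul_pow, sq_abs, sq_abs,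
    conj_trivial]
  ring

theorem mul_norm_le_norm_stretchMap {δ β : ℝ} (hδ : 0 ≤ δ) (hβ : 0 ≤ β) (a z : E) :
    δ * ‖z‖ ≤ ‖stretchMap δ β a z‖ := by
  refine le_of_sq_le_sq ?_ (norm_nonneg _)
  rw [norm_sq_stretchMap]
  have : 0 ≤ 2 * δ * β * inner ℝ a z ^ 2 := by positivity
  have : 0 ≤ (β * ‖a‖ * inner ℝ a z) ^ 2 := by positivity
  linarith

theorem mul_abs_inner_le_norm_stretchMap {δ β : ℝ} (hδ : 0 ≤ δ) (hβ : 0 ≤ β) (a z : E) :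
    β * ‖a‖ * |inner ℝ a z| ≤ ‖stretchMap δ β a z‖ := by
  refine le_of_sq_le_sq ?_ (norm_nonneg _)
  rw [norm_sq_stretchMap, mul_pow _ |_|, sq_abs, ← mul_pow]
  have : 0 ≤ 2 * δ * β * inner ℝ a z ^ 2 := by positivity
  have : 0 ≤ (δ * ‖z‖) ^ 2 := by positivity
  linarith

theorem stretchMap_injective {δ β : ℝ} (hδ : 0 < δ) (hβ : 0 ≤ β) (a : E) :
    Function.Injective (stretchMap δ β a) := by
  rw [injective_iff_map_eq_zero]
  intro z hz
  have := mul_norm_le_norm_stretchMap hδ.le hβ a z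
  rw [hz, norm_zero] at this
  exact norm_le_zero_iff.1 (nonpos_of_mul_nonpos_right this hδ)

end Stretch

/-- A criterion for a piece of orbit to be `δ`-dense, in terms of the dual lattice. -/
theorem mem_denseTimes_of_dual {α : EuclideanSpace ℝ (Fin n)} (hα : α ≠ 0) {δ T r : ℝ}
    (hδ : 0 < δ) (hT : 0 ≤ T) (hr : 0 < r) (hrd : (2 ^ dim α - 1) / 2 ≤ r)
    (hdual : ∀ k : ratHull α, k ≠ 0 → (∀ x ∈ lattice α, ∃ m : ℤ, inner ℝ k x = (m : ℝ)) →
      r ≤ δ * ‖k‖ ∨ r ≤ T / 2 * |∑ i, (k : EuclideanSpace ℝ (Fin n)) i * α i|) :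
    T ∈ denseTimes α δ := by
  set a : ratHull α := ⟨α, mem_ratHull α⟩ with ha
  have hapos : 0 < ‖a‖ := norm_pos_iff.2 fun h => hα (congrArg Subtype.val h)
  set β : ℝ := T / (2 * ‖a‖) with hβdef
  have hβ : 0 ≤ β := by positivity
  have hβa : β * ‖a‖ = T / 2 := by
    rw [hβdef]
    field_simp
  set M : ratHull α ≃ₗ[ℝ] ratHull α :=
    LinearEquiv.ofInjectiveEndo (stretchMap δ β a) (stretchMap_injective hδ hβ a) with hM
  have hMapp : ∀ z, M z = stretchMap δ β a z := fun z => rfl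
  refine ⟨hT, fun θ => ?_⟩
  obtain ⟨p, rfl⟩ := (lattice α).mkQ_surjective θ
  obtain ⟨y, hy, z, hpz, hz⟩ := exists_add_map_of_dual hr.le (lattice α) (finite_lattice α)
    (span_lattice α) M (fun x y => inner_stretchMap δ β a x y) (fun k hk0 hk => by
      rcases hdual k hk0 hk with h | h
      · exact h.trans (mul_norm_le_norm_stretchMap hδ.le hβ a k)
      · refine h.trans (le_trans (le_of_eq ?_) (mul_abs_inner_le_norm_stretchMap hδ.le hβ a k))
        rw [hβa, real_inner_comm, Submodule.coe_inner, inner_eq_sum]) (p - (T / 2) • a)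
  have hz1 : ‖z‖ ≤ 1 := le_of_mul_le_mul_left (by rw [mul_one]; exact hz.trans hrd) hr
  -- The covering was applied to `p - (T / 2) • a`, so this bound places the time `T / 2 + β ⟨a, z⟩`
  -- in `[0, T]`.
  have hshift : |β * inner ℝ a z| ≤ T / 2 := by
    rw [abs_mul, abs_of_nonneg hβ, ← hβa]
    gcongr
    calc |inner ℝ a z| ≤ ‖a‖ * ‖z‖ := abs_real_inner_le_norm a z
      _ ≤ ‖a‖ * 1 := by gcongr
      _ = ‖a‖ := mul_one _
  rw [abs_le] at hshift
  refine ⟨_, ⟨T / 2 + β * inner ℝ a z, by linarith, by linarith, rfl⟩, ?_⟩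
  have hp : p - (T / 2 + β * inner ℝ a z) • a = y + δ • z := by
    rw [hMapp, stretchMap_apply, sub_eq_iff_eq_add] at hpz
    rw [hpz, add_smul]
    abel
  have hy0 : (lattice α).mkQ y = 0 := (Submodule.Quotient.mk_eq_zero _).2 hy
  have hmk : (lattice α).mkQ (δ • z) =
      (lattice α).mkQ p - flow α (T / 2 + β * inner ℝ a z) 0 := by
    rw [flow_zero, ← map_sub, hp, map_add, hy0, zero_add]
  refine (torusDist_le hmk).trans ?_
  rw [Submodule.coe_smul, maxNorm_smul, abs_of_pos hδ]
  calc δ * maxNorm (z : EuclideanSpace ℝ (Fin n)) ≤ δ * 1 := by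
        gcongr
        exact (maxNorm_le_norm _).trans hz1
    _ = δ := mul_one δ

/-! ### The constant and the conclusion -/

theorem two_pow_le_sq_mul_factorial_add_one (d : ℕ) : 2 ^ d ≤ d ^ 2 * d.factorial + 1 := by
  rcases d with _ | d
  · simp
  · have h : 2 ^ d ≤ (d + 1).factorial := by
      induction d with
      | zero => simp
      | succ d ih =>
        rw [pow_succ, Nat.factorial_succ, mul_comm]
        exact Nat.mul_le_mul (by omega) ih
    rcases d with _ | d
    · simp
    · rw [pow_succ, mul_comm]
      have : 2 ≤ (d + 1 + 1) ^ 2 :=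
        (Nat.le_add_left 2 d).trans (Nat.le_self_pow two_ne_zero _)
      exact (Nat.mul_le_mul this h).trans (Nat.le_succ _)

theorem const_mul_Psi_mem_denseTimes {α : EuclideanSpace ℝ (Fin n)} (hα : α ≠ 0) {δ : ℝ}
    (hδ : 0 < δ) : const α * Psi α (2 * const α * δ⁻¹) ∈ denseTimes α δ := by
  have hd : 0 < dim α := by
    have : Nontrivial (ratHull α) :=
      ⟨⟨α, mem_ratHull α⟩, 0, fun h => hα (congrArg Subtype.val h)⟩
    exact Module.finrank_pos
  set e : ℝ := (dim α : ℝ) ^ 2 * ((dim α).factorial : ℝ) with he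
  have hepos : 0 < e := by
    have : 0 < (dim α).factorial := Nat.factorial_pos _
    positivity
  have hD : 0 < covol α ^ 2 := pow_pos (covol_pos α) 2
  have hconst : const α = e * covol α ^ 2 := rfl
  have hpow : (2 : ℝ) ^ dim α ≤ e + 1 := by
    rw [he]
    exact_mod_cast two_pow_le_sq_mul_factorial_add_one (dim α)
  have hPsi := Psi_nonneg α (2 * const α * δ⁻¹)
  -- The choice `r = e / 2` is allowed because `2 ^ d - 1 ≤ e`.
  refine mem_denseTimes_of_dual hα hδ (by rw [hconst]; positivity) (half_pos hepos)
    (by linarith) fun k hk0 hk => ?_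
  have hk' := covol_sq_smul_mem α hk
  have hk0' : covol α ^ 2 • k ≠ 0 := smul_ne_zero hD.ne' hk0
  rcases le_or_gt (maxNorm ((covol α ^ 2 • k : ratHull α) : EuclideanSpace ℝ (Fin n)))
    (2 * const α * δ⁻¹) with h | h
  · right
    have h1 := inv_abs_le_Psi hk' hk0' h
    have hne := abs_pos.2 (sum_mul_ne_zero hk' hk0')
    have hsum : ∑ i, ((covol α ^ 2 • k : ratHull α) : EuclideanSpace ℝ (Fin n)) i * α i =
        covol α ^ 2 * ∑ i, (k : EuclideanSpace ℝ (Fin n)) i * α i := by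
      simp [Finset.mul_sum, mul_assoc]
    rw [inv_le_iff_one_le_mul₀ hne, hsum, abs_mul, abs_of_pos hD] at h1
    have h2 := mul_le_mul_of_nonneg_left h1 (half_pos hepos).le
    rw [hconst] at h2 ⊢
    linarith
  · left
    rw [Submodule.coe_smul, maxNorm_smul, abs_of_pos hD, hconst] at h
    have h1 : covol α ^ 2 * (2 * e) < covol α ^ 2 *
        (δ * maxNorm (k : EuclideanSpace ℝ (Fin n))) := by
      have := mul_lt_mul_of_pos_left h hδ
      have h2 : δ * (2 * (e * covol α ^ 2) * δ⁻¹) = covol α ^ 2 * (2 * e) := by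
        field_simp
      linarith
    have h2 := lt_of_mul_lt_mul_left h1 hD.le
    have h3 : δ * maxNorm (k : EuclideanSpace ℝ (Fin n)) ≤ δ * ‖k‖ := by
      gcongr
      exact maxNorm_le_norm _
    linarith

end LinearFlow

end

theorem theorem1 (n : ℕ) (α : EuclideanSpace ℝ (Fin n)) (hα : ∃ i, α i = 1)
    (δ : ℝ) (hδ : 0 < δ)
    (hδ' : δ ≤ (LinearFlow.dim α : ℝ) ^ 2 * (((n : ℝ) + 2) * LinearFlow.shortest α)⁻¹) :
    IsLeast (LinearFlow.denseTimes α δ) (LinearFlow.ergodizationTime α δ) ∧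
      LinearFlow.ergodizationTime α δ ≤
        LinearFlow.const α * LinearFlow.Psi α (2 * LinearFlow.const α * δ⁻¹) := by
  have hα0 : α ≠ 0 := by
    rintro rfl
    obtain ⟨i, hi⟩ := hα
    simp at hi
  have hmem := LinearFlow.const_mul_Psi_mem_denseTimes hα0 hδ
  have hleast := LinearFlow.isLeast_ergodizationTime ⟨_, hmem⟩
  exact ⟨hleast, hleast.2 hmem⟩
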